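/- **Setting and algorithm.** Let $m=2^p$ be a power of two, let $0\ne A\in\mathbb R^{m\times n}$, let $b\in\mathrm{range}(A)$, and let $x^*=A^\dagger b$ be the minimum-length solution of $Ax=b$. Let $H\in\mathbb R^{m\times m}$ be the Hadamard matrix ($H_{1}=[1]$, $H_{2k}=\begin{bmatrix}H_k&H_k\\H_k&-H_k\end{bmatrix}$), let $D$ be any realization of the random diagonal sign matrix, and let $Q=\frac1{\sqrt m}HD$, $\bar A=QA$, $\bar b=Qb$. All probabilities and expectations below are for this fixed $D$. Fix a sample size $\tau\ge1$, a sketch dimension $\phi$, a distortion $0<\varepsilon<\frac12$, a failure probability $0\le\delta<\frac12$, and numbers $s_{\max}$, $t_{\max}$ of inner and outer iterations. Let $x_0\in\mathbb R^n$ be such that $x_0-x^*$ is orthogonal to the nullspace of $A$ (for example $x_0=0$). For $t=0,\dots,t_{\max}-1$ the algorithm does the following. 1. Draw $\tau$ independent uniform indices from $\{1,\dots,m\}$, independently of the past, and let $\tilde S$ be the set of distinct indices drawn. With $I_{\tilde S}$ the matrix of the rows of the $m\times m$ identity indexed by $\tilde S$, put $\tilde A=I_{\tilde S}\bar A$ and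 $\tilde b=I_{\tilde S}\bar A x_t-I_{\tilde S}\bar b$. 2. Draw a random matrix $\Phi\in\mathbb R^{\phi\times n}$ such that, conditionally on the past and on the drawn indices, with probability at least $1-\delta$ one has $$\tfrac1{1+\varepsilon}\|\tilde A^\top y\|\le\|\Phi\tilde A^\top y\|\le(1+\varepsilon)\|\tilde A^\top y\|\qquad\text{for all }y .$$ Compute a compact singular value decomposition $\Phi\tilde A^\top=U\Sigma V^\top$ (positive singular values only) and set $M=V\Sigma^{-1}$. 3. Let $u$ be the iterate after $s_{\max}$ steps of the conjugate gradient method for $(M^\top\tilde A\tilde A^\top M)u=M^\top\tilde b$ started from $0$, and set $x_{t+1}=x_t-\tilde A^\top M u$. Let $P_{\tilde S}=\bar A^\top I_{\tilde S}^\top(I_{\tilde S}\bar A\bar A^\top I_{\tilde S}^\top)^\dagger I_{\tilde S}\bar A$ with $\tilde S$ sampled as in step 1, and let $\rho=\lambda_{\min}^+(\mathbb E[P_{\tilde S}])$ be the smallest positive eigenvalue of $\mathbb E[P_{\tilde S}]$. **Lemma.** There is a universal constant $C>0$ such that, for all data as above, if $s_{\max}\ge C\left(1+\log\frac1\rho\right)$,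 then for every $t<t_{\max}$ the variable $\|x_{t+1}-x^*\|^2$ is integrable and, almost surely, $$\mathbb E\left[\|x_{t+1}-x^*\|^2\;\middle|\;\mathcal F_t\right]\le\left(1-\frac\rho4\right)\|x_t-x^*\|^2 ,$$ where $\mathcal F_t$ is the information available before iteration $t$ (with respect to which $x_t$ is measurable). -/

import Mathlib

open MeasureTheory ProbabilityTheory Matrix
open scoped ENNReal

noncomputable section

namespace SketchProject

/-- The Euclidean norm of a vector of real coordinates. -/
def norm2 {ι : Type*} [Fintype ι] (v : ι → ℝ) : ℝ :=
  ‖(WithLp.toLp 2 v : EuclideanSpace ℝ ι)‖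

/-! ### Moore–Penrose pseudoinverse -/

/-- The four Penrose equations for a real matrix. -/
structure IsPenroseInverse {ι κ : Type*} [Fintype ι] [Fintype κ]
    (A : Matrix ι κ ℝ) (X : Matrix κ ι ℝ) : Prop where
  mul_mul_left : A * X * A = A
  mul_mul_right : X * A * X = X
  symm_left : (A * X)ᵀ = A * X
  symm_right : (X * A)ᵀ = X * A

theorem exists_isPenroseInverse {ι κ : Type*} [Fintype ι] [Fintype κ]
    (A : Matrix ι κ ℝ) : ∃ X : Matrix κ ι ℝ, IsPenroseInverse A X := by
  classical
  have hG : (Aᵀ * A).IsHermitian := by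
    rw [Matrix.IsHermitian, conjTranspose_eq_transpose_of_trivial, transpose_mul,
      transpose_transpose]
  obtain ⟨U, D, hU, hGD⟩ : ∃ (U : Matrix κ κ ℝ) (D : κ → ℝ),
      Uᵀ * U = 1 ∧ Aᵀ * A = U * diagonal D * Uᵀ := by
    refine ⟨hG.eigenvectorUnitary, hG.eigenvalues, ?_, ?_⟩
    · simpa [star_eq_conjTranspose] using
        Unitary.coe_star_mul_self hG.eigenvectorUnitary
    · have := hG.spectral_theorem
      rw [Unitary.conjStarAlgAut_apply] at this
      simpa [star_eq_conjTranspose] using this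
  set K : Matrix κ κ ℝ := U * diagonal (fun i => (D i)⁻¹) * Uᵀ with hK
  have hKs : Kᵀ = K := by
    simp [hK, transpose_mul, Matrix.mul_assoc]
  have mulDiag : ∀ a b : κ → ℝ, (U * diagonal a * Uᵀ) * (U * diagonal b * Uᵀ) =
      U * diagonal (fun i => a i * b i) * Uᵀ := by
    intro a b
    calc _ = U * diagonal a * (Uᵀ * U) * diagonal b * Uᵀ := by simp only [Matrix.mul_assoc]
      _ = _ := by rw [hU, Matrix.mul_one, Matrix.mul_assoc U, diagonal_mul_diagonal]
  have hGKG : Aᵀ * A * K * (Aᵀ * A) = Aᵀ * A := by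
    rw [hK, hGD, mulDiag, mulDiag]
    congr 3
    funext i
    by_cases h : D i = 0
    · simp [h]
    · field_simp
  have hKGK : K * (Aᵀ * A) * K = K := by
    rw [hK, hGD, mulDiag, mulDiag]
    congr 3
    funext i
    by_cases h : D i = 0
    · simp [h]
    · field_simp
  have hKG : K * (Aᵀ * A) = Aᵀ * A * K := by
    rw [hK, hGD, mulDiag, mulDiag]
    congr 3
    funext i
    ring
  have hA : A * (K * (Aᵀ * A) - 1) = 0 := by
    have h := (conjTranspose_mul_self_mul_eq_zero A (K * (Aᵀ * A) - 1)).1 (by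
      rw [conjTranspose_eq_transpose_of_trivial, Matrix.mul_sub, ← Matrix.mul_assoc, hGKG,
        Matrix.mul_one, sub_self])
    exact h
  refine ⟨K * Aᵀ, ?_, ?_, ?_, ?_⟩
  · rw [Matrix.mul_sub, Matrix.mul_one, sub_eq_zero] at hA
    calc A * (K * Aᵀ) * A = A * (K * (Aᵀ * A)) := by rw [← Matrix.mul_assoc K, Matrix.mul_assoc]
      _ = A := hA
  · calc K * Aᵀ * A * (K * Aᵀ) = (K * (Aᵀ * A) * K) * Aᵀ := by simp only [Matrix.mul_assoc]
      _ = _ := by rw [hKGK]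
  · rw [transpose_mul, transpose_mul, transpose_transpose, hKs, Matrix.mul_assoc]
  · calc (K * Aᵀ * A)ᵀ = Aᵀ * A * K := by
          rw [transpose_mul, transpose_mul, transpose_transpose, hKs, Matrix.mul_assoc]
      _ = K * Aᵀ * A := hKG.symm.trans (Matrix.mul_assoc K Aᵀ A).symm

/-- The Moore–Penrose pseudoinverse `A†`. -/
def pinv {ι κ : Type*} [Fintype ι] [Fintype κ] (A : Matrix ι κ ℝ) : Matrix κ ι ℝ :=
  Classical.choose (exists_isPenroseInverse A)

theorem pinv_spec {ι κ : Type*} [Fintype ι] [Fintype κ] (A : Matrix ι κ ℝ) :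
    IsPenroseInverse A (pinv A) :=
  Classical.choose_spec (exists_isPenroseInverse A)

/-! ### Randomized Hadamard transform -/

/-- The `2 ^ p × 2 ^ p` Hadamard matrix, `H₀ = [1]` and
`H_{p+1} = [[H_p, H_p], [H_p, -H_p]]`. -/
def hadamardMatrix : (p : ℕ) → Matrix (Fin (2 ^ p)) (Fin (2 ^ p)) ℝ
  | 0 => 1
  | p + 1 =>
    let e : Fin (2 ^ (p + 1)) → Fin (2 ^ p) ⊕ Fin (2 ^ p) :=
      fun i => finSumFinEquiv.symm (Fin.cast (by rw [pow_succ, mul_two]) i)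
    (fromBlocks (hadamardMatrix p) (hadamardMatrix p) (hadamardMatrix p) (-hadamardMatrix p)).submatrix e e

/-- The transform `Q = m^{-1/2} H D`, where `m = 2 ^ p` and `D` is the diagonal matrix of the
signs `d`. -/
def rht (p : ℕ) (d : Fin (2 ^ p) → ℝ) : Matrix (Fin (2 ^ p)) (Fin (2 ^ p)) ℝ :=
  (Real.sqrt ((2 : ℝ) ^ p))⁻¹ • (hadamardMatrix p * diagonal d)

/-! ### Row sampling and the expected projection -/

/-- The set of distinct indices among the draws `i₀, …, i_{τ-1}`. -/
def sampleSet {m τ : ℕ} (i : Fin τ → Fin m) : Finset (Fin m) := Finset.univ.image i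

/-- The sampling matrix `I_S`: the rows of the identity matrix with index in `S`. -/
def rowSelect {m : ℕ} (S : Finset (Fin m)) : Matrix S (Fin m) ℝ :=
  (1 : Matrix (Fin m) (Fin m) ℝ).submatrix Subtype.val id

/-- `P_S = Bᵀ I_Sᵀ (I_S B Bᵀ I_Sᵀ)† I_S B`. -/
def proj {m n : ℕ} (B : Matrix (Fin m) (Fin n) ℝ) (S : Finset (Fin m)) :
    Matrix (Fin n) (Fin n) ℝ :=
  Bᵀ * (rowSelect S)ᵀ * pinv (rowSelect S * B * Bᵀ * (rowSelect S)ᵀ) * rowSelect S * B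

/-- `E[P_S]`, where `S` is the set of distinct indices among `τ` independent uniform draws
from the `m` row indices. -/
def expectedProj {m n : ℕ} (τ : ℕ) (B : Matrix (Fin m) (Fin n) ℝ) :
    Matrix (Fin n) (Fin n) ℝ :=
  ((m : ℝ) ^ τ)⁻¹ • ∑ i : Fin τ → Fin m, proj B (sampleSet i)

/-- The smallest positive eigenvalue (meaningful for a nonzero positive semidefinite matrix). -/
def lambdaMinPos {n : ℕ} (M : Matrix (Fin n) (Fin n) ℝ) : ℝ :=
  sInf {μ : ℝ | 0 < μ ∧ Module.End.HasEigenvalue (Matrix.toLin' M) μ}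

/-! ### Conjugate gradient -/

/-- The state of conjugate gradient: iterate, residual, search direction. -/
structure CGState (ι : Type*) where
  u : ι → ℝ
  r : ι → ℝ
  p : ι → ℝ

/-- One step of conjugate gradient for `G u = b`. When the residual is zero, both quotients are
`0 / 0 = 0` and the iterate does not move any more. -/
def cgStep {ι : Type*} [Fintype ι] (G : Matrix ι ι ℝ) (z : CGState ι) : CGState ι :=
  let α : ℝ := (z.r ⬝ᵥ z.r) / (z.p ⬝ᵥ (G *ᵥ z.p))
  let r' : ι → ℝ := z.r - α • (G *ᵥ z.p)
  let β : ℝ := (r' ⬝ᵥ r') / (z.r ⬝ᵥ z.r)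
  { u := z.u + α • z.p
    r := r'
    p := r' + β • z.p }

/-- `CG(B, b, s)`: the iterate after `s` steps of conjugate gradient for `(B Bᵀ) u = b`, started
from zero. -/
def cg {ι κ : Type*} [Fintype ι] [Fintype κ] (B : Matrix ι κ ℝ) (b : ι → ℝ) (s : ℕ) : ι → ℝ :=
  ((cgStep (B * Bᵀ))^[s] { u := 0, r := b, p := b }).u

/-! ### The sketched preconditioner -/

/-- `Φ` embeds the column space of `B` with distortion `1 + ε`. -/
def Embeds {φ : ℕ} {ι κ : Type*} [Fintype ι] [Fintype κ] (ε : ℝ)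
    (Φ : Matrix (Fin φ) ι ℝ) (B : Matrix ι κ ℝ) : Prop :=
  ∀ y : κ → ℝ, (1 + ε)⁻¹ * norm2 (B *ᵥ y) ≤ norm2 (Φ *ᵥ (B *ᵥ y)) ∧
    norm2 (Φ *ᵥ (B *ᵥ y)) ≤ (1 + ε) * norm2 (B *ᵥ y)

/-- `B = U Σ Vᵀ` is a compact singular value decomposition: `U` and `V` have orthonormal columns
and `Σ` is the diagonal matrix of the `q` positive singular values (so `q = rank B`). -/
structure IsCompactSVD {ι κ : Type*} [Fintype ι] [Fintype κ] {q : ℕ} (B : Matrix ι κ ℝ)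
    (U : Matrix ι (Fin q) ℝ) (σ : Fin q → ℝ) (V : Matrix κ (Fin q) ℝ) : Prop where
  orth_left : Uᵀ * U = 1
  orth_right : Vᵀ * V = 1
  pos : ∀ j, 0 < σ j
  eq_mul : B = U * diagonal σ * Vᵀ

/-- `M` is an output of the preconditioner routine on `C` with sketch `Φ`: `M = V Σ⁻¹` for a
compact singular value decomposition `Φ Cᵀ = U Σ Vᵀ`. -/
def IsPreconditioner {φ q : ℕ} {ι κ : Type*} [Fintype ι] [Fintype κ]
    (Φ : Matrix (Fin φ) κ ℝ) (C : Matrix ι κ ℝ) (M : Matrix ι (Fin q) ℝ) : Prop :=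
  ∃ (U : Matrix (Fin φ) (Fin q) ℝ) (σ : Fin q → ℝ) (V : Matrix ι (Fin q) ℝ),
    IsCompactSVD (Φ * Cᵀ) U σ V ∧ M = V * diagonal (fun j => (σ j)⁻¹)

/-! ### The solver -/

/-- One outer iteration of the solver for the (already transformed) system `B x = c`, with row
sample `S`, sketch `Φ` and `s` inner iterations, takes `x` to `x'`. -/
def IsOuterStep {m n φ : ℕ} (B : Matrix (Fin m) (Fin n) ℝ) (c : Fin m → ℝ) (s : ℕ)
    (S : Finset (Fin m)) (Φ : Matrix (Fin φ) (Fin n) ℝ) (x x' : Fin n → ℝ) : Prop :=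
  ∃ (q : ℕ) (M : Matrix S (Fin q) ℝ), IsPreconditioner Φ (rowSelect S * B) M ∧
    x' = x - (rowSelect S * B)ᵀ *ᵥ (M *ᵥ
      cg (Mᵀ * (rowSelect S * B))
        (Mᵀ *ᵥ (rowSelect S *ᵥ (B *ᵥ x) - rowSelect S *ᵥ c)) s)

/-- A run of the solver on `A x = b` with sign vector `d`, sample size `τ`, `smax` inner and `tmax`
outer iterations, started from `x₀`; `x t` is the `t`-th iterate and `F t` the information
available before iteration `t`. In iteration `t`, the `τ` indices `draw t` are independent
uniform draws, made independently of the past, and `Φ t` is the random sketch used for the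
preconditioner: for every outcome of the past and of the draws, it is an `ε`-embedding of the row
space of the sampled matrix with (conditional) probability at least `1 - δ`. -/
structure IsRun {p n τ φ : ℕ} {Ω : Type*} [mΩ : MeasurableSpace Ω] (μ : Measure Ω)
    (A : Matrix (Fin (2 ^ p)) (Fin n) ℝ) (b : Fin (2 ^ p) → ℝ) (d : Fin (2 ^ p) → ℝ)
    (ε δ : ℝ) (smax tmax : ℕ) (x₀ : Fin n → ℝ) (F : Filtration ℕ mΩ)
    (draw : ℕ → Ω → Fin τ → Fin (2 ^ p)) (Φ : ℕ → Ω → Matrix (Fin φ) (Fin n) ℝ)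
    (x : ℕ → Ω → Fin n → ℝ) : Prop where
  adapted : ∀ t ≤ tmax, Measurable[F t] (x t)
  measurable_draw : ∀ t < tmax, Measurable (draw t)
  measurable_sketch : ∀ t < tmax, ∀ i j, Measurable fun ω => Φ t ω i j
  uniform_draw : ∀ t < tmax, ∀ i : Fin τ → Fin (2 ^ p),
    μ.real (draw t ⁻¹' {i}) = (((2 : ℝ) ^ p) ^ τ)⁻¹
  indep_draw : ∀ t < tmax, Indep (MeasurableSpace.comap (draw t) inferInstance) (F t) μ
  embeds : ∀ t < tmax, ∀ᵐ ω ∂μ, 1 - δ ≤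
    (μ⟦{ω' | Embeds ε (Φ t ω') (rowSelect (sampleSet (draw t ω')) * (rht p d * A))ᵀ} |
      F t ⊔ MeasurableSpace.comap (draw t) inferInstance⟧) ω
  init : ∀ᵐ ω ∂μ, x 0 ω = x₀
  step : ∀ t < tmax, ∀ᵐ ω ∂μ,
    IsOuterStep (rht p d * A) (rht p d *ᵥ b) smax (sampleSet (draw t ω)) (Φ t ω)
      (x t ω) (x (t + 1) ω)

end SketchProject

end

open SketchProject

open SketchProject


namespace SketchProject

/-! Write e = x_t - x*, C = I_S QA and T = Mᵀ C. Since b = A x*, the inner system is T Tᵀ u = T e,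
so the outer error e - Tᵀ u is exactly the error that conjugate gradient decreases. It never grows,
whatever M is (`cg_error_le`), so a failed sketch does no harm.

If the sketch embeds the row space of C, the nonzero singular values of C preconditioned by M lie in
[1/(1+ε), 1+ε], and Tᵀ has the same range as Cᵀ. Instead of Krylov optimality, the proof uses only
that a CG step is at least as good as a gradient step of length 1/L. Each step contracts the squared
error inside that range by 1 - (1+ε)⁻⁴ < 65/81, so four steps halve it, and the new squared error is
at most ‖e‖² - ½‖P_S e‖² (`IsOuterStep.error_le_of_embeds`).

Conditioning on the past and the draws turns ½ into (1-δ)/2 ≥ ¼; averaging over the independent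
draws replaces ‖P_S e‖² by eᵀ E[P_S] e (`IsRun.condExp_error_le`). Updates lie in the row space of
A, so e stays orthogonal to the nullspace of A, which contains that of E[P_S]; the spectral theorem
then gives eᵀ E[P_S] e ≥ ρ‖e‖² (`lambdaMinPos_mul_le`). -/

theorem norm2_sq {ι : Type*} [Fintype ι] (v : ι → ℝ) : norm2 v ^ 2 = v ⬝ᵥ v := by
  rw [norm2, EuclideanSpace.norm_sq_eq]
  simp [dotProduct, sq]

theorem norm2_nonneg {ι : Type*} [Fintype ι] (v : ι → ℝ) : 0 ≤ norm2 v := norm_nonneg _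

theorem dotProduct_self_nonneg_real {ι : Type*} [Fintype ι] (v : ι → ℝ) : 0 ≤ v ⬝ᵥ v := by
  rw [← norm2_sq]; positivity

theorem dotProduct_mul_transpose_mulVec {ι κ : Type*} [Fintype ι] [Fintype κ]
    (B : Matrix ι κ ℝ) (v w : ι → ℝ) :
    v ⬝ᵥ ((B * Bᵀ) *ᵥ w) = (Bᵀ *ᵥ v) ⬝ᵥ (Bᵀ *ᵥ w) := by
  rw [← mulVec_mulVec, dotProduct_mulVec, ← mulVec_transpose]

theorem mulVec_dotProduct {ι κ : Type*} [Fintype ι] [Fintype κ]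
    (B : Matrix ι κ ℝ) (e : κ → ℝ) (v : ι → ℝ) :
    (B *ᵥ e) ⬝ᵥ v = e ⬝ᵥ (Bᵀ *ᵥ v) := by
  rw [dotProduct_comm, dotProduct_mulVec, mulVec_transpose, dotProduct_comm]

/-! ### Conjugate gradient -/

/-- The local orthogonality relations of conjugate gradient applied to `B Bᵀ u = B e`. -/
structure CGInvariant {ι κ : Type*} [Fintype ι] [Fintype κ] (B : Matrix ι κ ℝ) (e : κ → ℝ)
    (z : CGState ι) : Prop where
  residual : z.r = B *ᵥ (e - Bᵀ *ᵥ z.u)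
  residual_direction : z.r ⬝ᵥ z.p = z.r ⬝ᵥ z.r
  residual_conj : (Bᵀ *ᵥ z.r) ⬝ᵥ (Bᵀ *ᵥ z.p) = (Bᵀ *ᵥ z.p) ⬝ᵥ (Bᵀ *ᵥ z.p)
  direction_le : (Bᵀ *ᵥ z.p) ⬝ᵥ (Bᵀ *ᵥ z.p) ≤ (Bᵀ *ᵥ z.r) ⬝ᵥ (Bᵀ *ᵥ z.r)

namespace CGInvariant

variable {ι κ : Type*} [Fintype ι] [Fintype κ] {B : Matrix ι κ ℝ} {e : κ → ℝ} {z : CGState ι}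

/-- r ⬝ r = r ⬝ p = (e - Bᵀ u) ⬝ Bᵀ p, so the denominator of the step length vanishes only after
convergence. -/
theorem residual_eq_zero (h : CGInvariant B e z)
    (h0 : (Bᵀ *ᵥ z.p) ⬝ᵥ (Bᵀ *ᵥ z.p) = 0) : z.r = 0 := by
  rw [dotProduct_self_eq_zero] at h0
  have h1 := h.residual_direction
  nth_rewrite 1 [h.residual] at h1
  rw [mulVec_dotProduct, h0, dotProduct_zero] at h1
  exact dotProduct_self_eq_zero.1 h1.symm

theorem step (h : CGInvariant B e z) : CGInvariant B e (cgStep (B * Bᵀ) z) := by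
  by_cases h0 : (Bᵀ *ᵥ z.p) ⬝ᵥ (Bᵀ *ᵥ z.p) = 0
  · have hr := h.residual_eq_zero h0
    have hres := h.residual
    rw [hr] at hres
    constructor <;> simp [cgStep, dotProduct_mul_transpose_mulVec, h0, hr, ← hres]
  · have hrr : z.r ⬝ᵥ z.r ≠ 0 := by
      intro h1
      have hr := dotProduct_self_eq_zero.1 h1
      have := h.residual_conj
      rw [hr, mulVec_zero, zero_dotProduct] at this
      exact h0 this.symm
    obtain ⟨h1, h2, h3, h4⟩ := h
    obtain ⟨u, r, p⟩ := z
    simp only at *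
    set γ := (Bᵀ *ᵥ p) ⬝ᵥ (Bᵀ *ᵥ p) with hγ
    set ν := r ⬝ᵥ r with hν
    set α := ν / γ with hα
    have hα0 : α ≠ 0 := div_ne_zero hrr h0
    set r' := r - α • ((B * Bᵀ) *ᵥ p) with hr'
    set β := (r' ⬝ᵥ r') / ν with hβ
    have hstep : cgStep (B * Bᵀ) ⟨u, r, p⟩ = ⟨u + α • p, r', r' + β • p⟩ := by
      simp only [cgStep, dotProduct_mul_transpose_mulVec, ← hγ, ← hν, ← hα, ← hr', ← hβ]
    rw [hstep]
    have hαγ : α * γ = ν := div_mul_cancel₀ _ h0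
    have e1 : r' ⬝ᵥ p = 0 := by
      rw [hr', sub_dotProduct, smul_dotProduct, dotProduct_comm (_ *ᵥ _) p,
        dotProduct_mul_transpose_mulVec, ← hγ, h2, smul_eq_mul, hαγ, sub_self]
    have e2 : r' ⬝ᵥ r = 0 := by
      rw [hr', sub_dotProduct, smul_dotProduct, dotProduct_comm (_ *ᵥ _) r,
        dotProduct_mul_transpose_mulVec, h3, smul_eq_mul, hαγ, sub_self]
    have e3 : α * ((Bᵀ *ᵥ r') ⬝ᵥ (Bᵀ *ᵥ p)) = - (r' ⬝ᵥ r') := by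
      have : α • ((B * Bᵀ) *ᵥ p) = r - r' := by rw [hr']; abel
      rw [← dotProduct_mul_transpose_mulVec, ← smul_eq_mul, ← dotProduct_smul, this,
        dotProduct_sub, e2, zero_sub]
    -- β is chosen to make r' + β p conjugate to p; the last two invariants both follow from this
    -- relation.
    have e4 : (Bᵀ *ᵥ r') ⬝ᵥ (Bᵀ *ᵥ p) + β * γ = 0 := by
      apply mul_left_cancel₀ hα0
      rw [mul_add, e3, hβ, ← hαγ]
      field_simp
      ring
    constructor
    · simp only
      rw [hr', h1, mulVec_add, mulVec_smul, ← sub_sub, mulVec_sub B (e - Bᵀ *ᵥ u), mulVec_smul,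
        mulVec_mulVec p]
    · simp only [dotProduct_add, dotProduct_smul, e1, smul_zero, add_zero]
    · simp only [mulVec_add, mulVec_smul, dotProduct_add, add_dotProduct, dotProduct_smul,
        smul_dotProduct, smul_eq_mul, ← hγ]
      rw [dotProduct_comm (Bᵀ *ᵥ p)]
      linear_combination (-β) * e4
    · simp only [mulVec_add, mulVec_smul, dotProduct_add, add_dotProduct, dotProduct_smul,
        smul_dotProduct, smul_eq_mul, ← hγ]
      rw [dotProduct_comm (Bᵀ *ᵥ p)]
      have : 0 ≤ β * β * γ := mul_nonneg (mul_self_nonneg _) (dotProduct_self_nonneg_real _)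
      linear_combination 2 * β * e4 + this

theorem iterate (B : Matrix ι κ ℝ) (e : κ → ℝ) (s : ℕ) :
    CGInvariant B e ((cgStep (B * Bᵀ))^[s] { u := 0, r := B *ᵥ e, p := B *ᵥ e }) := by
  induction s with
  | zero => constructor <;> simp
  | succ s ih => rw [Function.iterate_succ_apply']; exact ih.step

/-- Since (e - Bᵀ u) ⬝ Bᵀ p = r ⬝ p = r ⬝ r, the step length is that of an exact line search along
p. -/
theorem error_step (h : CGInvariant B e z) :
    (e - Bᵀ *ᵥ (cgStep (B * Bᵀ) z).u) ⬝ᵥ (e - Bᵀ *ᵥ (cgStep (B * Bᵀ) z).u) =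
      (e - Bᵀ *ᵥ z.u) ⬝ᵥ (e - Bᵀ *ᵥ z.u) -
        (z.r ⬝ᵥ z.r) ^ 2 / ((Bᵀ *ᵥ z.p) ⬝ᵥ (Bᵀ *ᵥ z.p)) := by
  set w := e - Bᵀ *ᵥ z.u with hw
  set γ := (Bᵀ *ᵥ z.p) ⬝ᵥ (Bᵀ *ᵥ z.p) with hγ
  set ν := z.r ⬝ᵥ z.r with hν
  have hu : e - Bᵀ *ᵥ (cgStep (B * Bᵀ) z).u = w - (ν / γ) • (Bᵀ *ᵥ z.p) := by
    simp only [cgStep, dotProduct_mul_transpose_mulVec, ← hγ, ← hν, mulVec_add, mulVec_smul, hw]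
    abel
  have h1 : w ⬝ᵥ (Bᵀ *ᵥ z.p) = ν := by
    rw [← mulVec_dotProduct, hw, ← h.residual, h.residual_direction]
  clear_value w
  rw [hu, sub_dotProduct, dotProduct_sub, dotProduct_sub, smul_dotProduct, smul_dotProduct,
    dotProduct_smul, dotProduct_smul, dotProduct_comm (_ *ᵥ _) w, h1, ← hγ]
  simp only [smul_eq_mul]
  by_cases h0 : γ = 0
  · simp [h0]
  · field_simp
    ring

theorem error_step_le (h : CGInvariant B e z) :
    (e - Bᵀ *ᵥ (cgStep (B * Bᵀ) z).u) ⬝ᵥ (e - Bᵀ *ᵥ (cgStep (B * Bᵀ) z).u) ≤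
      (e - Bᵀ *ᵥ z.u) ⬝ᵥ (e - Bᵀ *ᵥ z.u) := by
  rw [h.error_step]
  have : 0 ≤ (z.r ⬝ᵥ z.r) ^ 2 / ((Bᵀ *ᵥ z.p) ⬝ᵥ (Bᵀ *ᵥ z.p)) :=
    div_nonneg (sq_nonneg _) (dotProduct_self_nonneg_real _)
  linarith

/-- A conjugate gradient step decreases the energy at least as much as a gradient step of
length `1 / L`. -/
theorem error_step_le_sub (h : CGInvariant B e z) {L : ℝ} (hL : 0 < L)
    (hB : ∀ v, (Bᵀ *ᵥ v) ⬝ᵥ (Bᵀ *ᵥ v) ≤ L * (v ⬝ᵥ v)) :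
    (e - Bᵀ *ᵥ (cgStep (B * Bᵀ) z).u) ⬝ᵥ (e - Bᵀ *ᵥ (cgStep (B * Bᵀ) z).u) ≤
      (e - Bᵀ *ᵥ z.u) ⬝ᵥ (e - Bᵀ *ᵥ z.u) - (z.r ⬝ᵥ z.r) / L := by
  rw [h.error_step]
  have h1 := h.direction_le.trans (hB z.r)
  have h2 : (z.r ⬝ᵥ z.r) / L ≤ (z.r ⬝ᵥ z.r) ^ 2 / ((Bᵀ *ᵥ z.p) ⬝ᵥ (Bᵀ *ᵥ z.p)) := by
    by_cases h0 : (Bᵀ *ᵥ z.p) ⬝ᵥ (Bᵀ *ᵥ z.p) = 0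
    · simp [h.residual_eq_zero h0]
    · have hpos := lt_of_le_of_ne (dotProduct_self_nonneg_real (Bᵀ *ᵥ z.p)) (Ne.symm h0)
      rw [div_le_div_iff₀ hL hpos, sq, mul_assoc]
      refine mul_le_mul_of_nonneg_left ?_ (dotProduct_self_nonneg_real _)
      linarith
  linarith

end CGInvariant

/-! ### Convergence of the conjugate gradient iterates -/

section CG

variable {ι κ : Type*} [Fintype ι] [Fintype κ] (B : Matrix ι κ ℝ) (e : κ → ℝ)

/-- No spectral condition on B is needed, so this also covers iterations whose sketch fails. -/
theorem cg_error_le (s : ℕ) :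
    (e - Bᵀ *ᵥ cg B (B *ᵥ e) s) ⬝ᵥ (e - Bᵀ *ᵥ cg B (B *ᵥ e) s) ≤ e ⬝ᵥ e := by
  induction s with
  | zero => simp [cg]
  | succ s ih =>
    refine le_trans ?_ ih
    simp only [cg, Function.iterate_succ_apply']
    exact (CGInvariant.iterate B e s).error_step_le

/-- If the squared singular values of `Bᵀ` lie in `[ℓ, L]`, then conjugate gradient for
`B Bᵀ u = B (Bᵀ y + w)`, with `B w = 0`, contracts the squared error by `1 - ℓ / L` per step. -/
theorem cg_error_le_pow {ℓ L : ℝ} (hℓ : 0 < ℓ) (hℓL : ℓ ≤ L)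
    (hl : ∀ v, ℓ * (v ⬝ᵥ v) ≤ (Bᵀ *ᵥ v) ⬝ᵥ (Bᵀ *ᵥ v))
    (hu : ∀ v, (Bᵀ *ᵥ v) ⬝ᵥ (Bᵀ *ᵥ v) ≤ L * (v ⬝ᵥ v))
    (y : ι → ℝ) (w : κ → ℝ) (hw : B *ᵥ w = 0) (he : e = Bᵀ *ᵥ y + w) (s : ℕ) :
    (e - Bᵀ *ᵥ cg B (B *ᵥ e) s) ⬝ᵥ (e - Bᵀ *ᵥ cg B (B *ᵥ e) s) ≤
      w ⬝ᵥ w + (1 - ℓ / L) ^ s * ((Bᵀ *ᵥ y) ⬝ᵥ (Bᵀ *ᵥ y)) := by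
  have hL : 0 < L := hℓ.trans_le hℓL
  have horth : ∀ v, (Bᵀ *ᵥ v) ⬝ᵥ w = 0 := fun v => by
    rw [dotProduct_comm, ← mulVec_dotProduct, hw, zero_dotProduct]
  have hpyth : ∀ v, (e - Bᵀ *ᵥ v) ⬝ᵥ (e - Bᵀ *ᵥ v) =
      w ⬝ᵥ w + (Bᵀ *ᵥ (y - v)) ⬝ᵥ (Bᵀ *ᵥ (y - v)) := fun v => by
    have : e - Bᵀ *ᵥ v = Bᵀ *ᵥ (y - v) + w := by rw [he, mulVec_sub]; abel
    rw [this, add_dotProduct, dotProduct_add, dotProduct_add, dotProduct_comm w, horth]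
    ring
  induction s with
  | zero => simpa [cg] using (hpyth 0).le
  | succ s ih =>
    have hinv := CGInvariant.iterate B e s
    have hstep := hinv.error_step_le_sub hL hu
    have hres := hinv.residual
    simp only [cg, Function.iterate_succ_apply'] at ih ⊢
    set z := (cgStep (B * Bᵀ))^[s] { u := 0, r := B *ᵥ e, p := B *ᵥ e }
    set a := Bᵀ *ᵥ (y - z.u) with ha
    have hr : z.r = B *ᵥ a := by
      rw [hres, he, ha, mulVec_sub Bᵀ, add_sub_right_comm, mulVec_add, hw, add_zero]
    -- Cauchy–Schwarz together with ℓ‖y - u‖² ≤ ‖a‖² bounds the residual below: ℓ‖a‖² ≤ ‖r‖².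
    have hcs : (a ⬝ᵥ a) ^ 2 ≤ ((y - z.u) ⬝ᵥ (y - z.u)) * (z.r ⬝ᵥ z.r) := by
      have h1 : a ⬝ᵥ a = (y - z.u) ⬝ᵥ z.r := by
        rw [hr, dotProduct_comm, mulVec_dotProduct, transpose_transpose]
      rw [h1]
      simpa only [dotProduct, sq] using
        Finset.sum_mul_sq_le_sq_mul_sq Finset.univ (y - z.u) z.r
    have hlow : ℓ * (a ⬝ᵥ a) ≤ z.r ⬝ᵥ z.r := by
      rcases (dotProduct_self_nonneg_real a).eq_or_lt with h0 | h0
      · rw [← h0, mul_zero]; exact dotProduct_self_nonneg_real _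
      · have h1 := hl (y - z.u)
        rw [← ha] at h1
        have h2 : ℓ * (a ⬝ᵥ a) ^ 2 ≤ (a ⬝ᵥ a) * (z.r ⬝ᵥ z.r) :=
          calc _ ≤ ℓ * (((y - z.u) ⬝ᵥ (y - z.u)) * (z.r ⬝ᵥ z.r)) := by gcongr
            _ = (ℓ * ((y - z.u) ⬝ᵥ (y - z.u))) * (z.r ⬝ᵥ z.r) := by ring
            _ ≤ _ := mul_le_mul_of_nonneg_right h1 (dotProduct_self_nonneg_real _)
        refine le_of_mul_le_mul_left ?_ h0
        linarith
    have hdiv : ℓ / L * (a ⬝ᵥ a) ≤ (z.r ⬝ᵥ z.r) / L := by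
      rw [div_mul_eq_mul_div]; gcongr
    rw [hpyth z.u, ← ha] at ih hstep
    have hfac : 0 ≤ 1 - ℓ / L := by
      rw [sub_nonneg, div_le_one hL]; exact hℓL
    have := mul_le_mul_of_nonneg_left (le_of_add_le_add_left ih) hfac
    rw [pow_succ']
    linarith

end CG

/-! ### The projections -/

section Projection

variable {ι κ : Type*} [Fintype ι] [Fintype κ]

theorem proj_eq {m n : ℕ} (B : Matrix (Fin m) (Fin n) ℝ) (S : Finset (Fin m)) :
    proj B S = (rowSelect S * B)ᵀ *
      (pinv ((rowSelect S * B) * (rowSelect S * B)ᵀ) * (rowSelect S * B)) := by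
  simp only [proj, transpose_mul, Matrix.mul_assoc]

/-- X C Cᵀ = 0 forces X C = 0; this is applied to X = C Cᵀ (C Cᵀ)† - 1. -/
theorem mul_transpose_pinv_mul (C : Matrix ι κ ℝ) : C * (Cᵀ * (pinv (C * Cᵀ) * C)) = C := by
  classical
  have h := (pinv_spec (C * Cᵀ)).mul_mul_left
  have h2 := (mul_self_mul_conjTranspose_eq_zero C (C * Cᵀ * pinv (C * Cᵀ) - 1)).1 (by
    rw [conjTranspose_eq_transpose_of_trivial, Matrix.sub_mul, h, Matrix.one_mul, sub_self])
  rw [Matrix.sub_mul, Matrix.one_mul, sub_eq_zero] at h2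
  simpa only [Matrix.mul_assoc] using h2

variable {m n : ℕ} (B : Matrix (Fin m) (Fin n) ℝ) (S : Finset (Fin m))

theorem mul_proj : rowSelect S * B * proj B S = rowSelect S * B := by
  rw [proj_eq, mul_transpose_pinv_mul]

/-- The transpose Pᵀ ends in the factor C = I_S B, and C P = C. As Pᵀ P is symmetric, this yields
symmetry and idempotence of P at once. -/
theorem proj_transpose_mul : (proj B S)ᵀ * proj B S = (proj B S)ᵀ := by
  have h : (proj B S)ᵀ = (rowSelect S * B)ᵀ *
      (pinv ((rowSelect S * B) * (rowSelect S * B)ᵀ))ᵀ * (rowSelect S * B) := by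
    rw [proj_eq, transpose_mul, transpose_mul, transpose_transpose]
  nth_rewrite 1 [h]
  rw [Matrix.mul_assoc, mul_proj, ← h]

theorem proj_transpose : (proj B S)ᵀ = proj B S := by
  have h := congrArg transpose (proj_transpose_mul B S)
  rw [transpose_mul, transpose_transpose, proj_transpose_mul] at h
  exact h

theorem dotProduct_proj (e : Fin n → ℝ) :
    e ⬝ᵥ (proj B S *ᵥ e) = (proj B S *ᵥ e) ⬝ᵥ (proj B S *ᵥ e) := by
  rw [mulVec_dotProduct, mulVec_mulVec, proj_transpose_mul, proj_transpose]

theorem dotProduct_self_eq_proj_add (e : Fin n → ℝ) :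
    e ⬝ᵥ e = (proj B S *ᵥ e) ⬝ᵥ (proj B S *ᵥ e) +
      (e - proj B S *ᵥ e) ⬝ᵥ (e - proj B S *ᵥ e) := by
  rw [sub_dotProduct, dotProduct_sub, dotProduct_sub, dotProduct_comm (_ *ᵥ _) e, dotProduct_proj]
  ring

end Projection

/-! ### One outer step -/

/-- Preconditioning loses no part of the row space: Φ Cᵀ annihilates y - V Vᵀ y, and the lower
embedding bound lets Φ be cancelled. -/
theorem IsPreconditioner.exists_eq {φ q : ℕ} {ι κ : Type*} [Fintype ι] [Fintype κ] {ε : ℝ}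
    {Φ : Matrix (Fin φ) κ ℝ} {C : Matrix ι κ ℝ} {M : Matrix ι (Fin q) ℝ}
    (hM : IsPreconditioner Φ C M) (hε : 0 < ε) (hΦ : Embeds ε Φ Cᵀ) (y : ι → ℝ) :
    ∃ v, Cᵀ *ᵥ y = Cᵀ *ᵥ (M *ᵥ v) := by
  obtain ⟨U, σ, V, h, rfl⟩ := hM
  refine ⟨diagonal σ *ᵥ (Vᵀ *ᵥ y), ?_⟩
  have hd : diagonal (fun j => (σ j)⁻¹) * diagonal σ = 1 := by
    rw [diagonal_mul_diagonal, ← diagonal_one]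
    congr 1
    funext j
    exact inv_mul_cancel₀ (h.pos j).ne'
  have h1 : (V * diagonal (fun j => (σ j)⁻¹)) *ᵥ (diagonal σ *ᵥ (Vᵀ *ᵥ y)) =
      V *ᵥ (Vᵀ *ᵥ y) := by
    rw [mulVec_mulVec, Matrix.mul_assoc, hd, Matrix.mul_one]
  rw [h1, ← sub_eq_zero, ← mulVec_sub]
  have h2 : Φ *ᵥ (Cᵀ *ᵥ (y - V *ᵥ (Vᵀ *ᵥ y))) = 0 := by
    rw [mulVec_mulVec, h.eq_mul, ← mulVec_mulVec, mulVec_sub, mulVec_mulVec _ Vᵀ V, h.orth_right,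
      one_mulVec, sub_self, mulVec_zero]
  have h3 := (hΦ (y - V *ᵥ (Vᵀ *ᵥ y))).1
  rw [h2, show norm2 (0 : Fin φ → ℝ) = 0 by simp [norm2]] at h3
  have h4 : norm2 (Cᵀ *ᵥ (y - V *ᵥ (Vᵀ *ᵥ y))) ≤ 0 := by
    have : 0 < (1 + ε)⁻¹ := by positivity
    by_contra! hlt
    exact absurd h3 (not_le.2 (mul_pos this hlt))
  rw [← dotProduct_self_eq_zero, ← norm2_sq, le_antisymm h4 (norm2_nonneg _)]
  norm_num

/-- Φ Cᵀ M = U has orthonormal columns. The embedding bounds thereby become bounds on the singular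
values of Cᵀ M. -/
theorem IsPreconditioner.sketch_mulVec {φ q : ℕ} {ι κ : Type*} [Fintype ι] [Fintype κ]
    {Φ : Matrix (Fin φ) κ ℝ} {C : Matrix ι κ ℝ} {M : Matrix ι (Fin q) ℝ}
    (hM : IsPreconditioner Φ C M) (v : Fin q → ℝ) :
    norm2 (Φ *ᵥ (Cᵀ *ᵥ (M *ᵥ v))) = norm2 v := by
  obtain ⟨U, σ, V, h, rfl⟩ := hM
  have hd : diagonal σ * diagonal (fun j => (σ j)⁻¹) = 1 := by
    rw [diagonal_mul_diagonal, ← diagonal_one]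
    congr 1
    funext j
    exact mul_inv_cancel₀ (h.pos j).ne'
  have h1 : Φ *ᵥ (Cᵀ *ᵥ ((V * diagonal (fun j => (σ j)⁻¹)) *ᵥ v)) = U *ᵥ v := by
    rw [mulVec_mulVec, mulVec_mulVec, h.eq_mul]
    congr 1
    calc _ = U * diagonal σ * (Vᵀ * V) * diagonal (fun j => (σ j)⁻¹) := by
          simp only [Matrix.mul_assoc]
      _ = U := by rw [h.orth_right, Matrix.mul_one, Matrix.mul_assoc, hd, Matrix.mul_one]
  rw [h1, ← sq_eq_sq₀ (norm2_nonneg _) (norm2_nonneg _), norm2_sq, norm2_sq, mulVec_dotProduct,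
    mulVec_mulVec, h.orth_left, one_mulVec]

section OuterStep

variable {m n φ s : ℕ} {B : Matrix (Fin m) (Fin n) ℝ} {S : Finset (Fin m)}
  {Φ : Matrix (Fin φ) (Fin n) ℝ} {x x' xs : Fin n → ℝ}

theorem IsOuterStep.exists_cg (h : IsOuterStep B (B *ᵥ xs) s S Φ x x') :
    ∃ (q : ℕ) (M : Matrix S (Fin q) ℝ), IsPreconditioner Φ (rowSelect S * B) M ∧
      x' - xs = (x - xs) - (Mᵀ * (rowSelect S * B))ᵀ *ᵥ
        cg (Mᵀ * (rowSelect S * B)) ((Mᵀ * (rowSelect S * B)) *ᵥ (x - xs)) s := by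
  obtain ⟨q, M, hM, rfl⟩ := h
  refine ⟨q, M, hM, ?_⟩
  have h1 : Mᵀ *ᵥ (rowSelect S *ᵥ (B *ᵥ x) - rowSelect S *ᵥ (B *ᵥ xs)) =
      (Mᵀ * (rowSelect S * B)) *ᵥ (x - xs) := by
    rw [← mulVec_sub, ← mulVec_sub, mulVec_mulVec, mulVec_mulVec, Matrix.mul_assoc]
  rw [h1, transpose_mul Mᵀ, transpose_transpose, ← mulVec_mulVec _ (rowSelect S * B)ᵀ M]
  abel

theorem IsOuterStep.error_le (h : IsOuterStep B (B *ᵥ xs) s S Φ x x') :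
    (x' - xs) ⬝ᵥ (x' - xs) ≤ (x - xs) ⬝ᵥ (x - xs) := by
  obtain ⟨q, M, -, h⟩ := h.exists_cg
  rw [h]
  exact cg_error_le _ _ _

theorem IsOuterStep.dotProduct_eq_zero (h : IsOuterStep B (B *ᵥ xs) s S Φ x x')
    {z : Fin n → ℝ} (hz : B *ᵥ z = 0) (hx : (x - xs) ⬝ᵥ z = 0) : (x' - xs) ⬝ᵥ z = 0 := by
  obtain ⟨q, M, -, h⟩ := h.exists_cg
  rw [h, sub_dotProduct, hx, dotProduct_comm, ← mulVec_dotProduct, ← mulVec_mulVec,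
    ← mulVec_mulVec, hz]
  simp

theorem IsOuterStep.error_le_of_embeds {ε : ℝ} (hε : 0 < ε) (hε' : ε < 1 / 2) (hs : 4 ≤ s)
    (hΦ : Embeds ε Φ (rowSelect S * B)ᵀ) (h : IsOuterStep B (B *ᵥ xs) s S Φ x x') :
    (x' - xs) ⬝ᵥ (x' - xs) ≤ (x - xs) ⬝ᵥ (x - xs) -
      (1 / 2) * ((proj B S *ᵥ (x - xs)) ⬝ᵥ (proj B S *ᵥ (x - xs))) := by
  obtain ⟨q, M, hM, h⟩ := h.exists_cg
  set C := rowSelect S * B with hC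
  set e := x - xs
  have hT : ∀ v, (Mᵀ * C)ᵀ *ᵥ v = Cᵀ *ᵥ (M *ᵥ v) := fun v => by
    rw [transpose_mul, transpose_transpose, mulVec_mulVec]
  have h1 : 0 < 1 + ε := by linarith
  -- The splitting e = P e + (e - P e) puts the first part in the range of (Mᵀ C)ᵀ and the second in
  -- the kernel of Mᵀ C, so CG contracts the first and leaves the second.
  obtain ⟨y, hy⟩ : ∃ y, proj B S *ᵥ e = (Mᵀ * C)ᵀ *ᵥ y := by
    obtain ⟨v, hv⟩ := hM.exists_eq hε hΦ ((pinv (C * Cᵀ) * C) *ᵥ e)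
    exact ⟨v, by rw [hT, ← hv, mulVec_mulVec, proj_eq]⟩
  have hw : (Mᵀ * C) *ᵥ (e - proj B S *ᵥ e) = 0 := by
    rw [← mulVec_mulVec, mulVec_sub, mulVec_mulVec, mul_proj, sub_self, mulVec_zero]
  have hb : ∀ v, (1 + ε)⁻¹ * norm2 ((Mᵀ * C)ᵀ *ᵥ v) ≤ norm2 v ∧
      norm2 v ≤ (1 + ε) * norm2 ((Mᵀ * C)ᵀ *ᵥ v) := fun v => by
    have := hΦ (M *ᵥ v)
    rwa [hM.sketch_mulVec, ← hT] at this
  have hle1 : (1 : ℝ) ≤ (1 + ε) ^ 2 := one_le_pow₀ (by linarith)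
  have key := cg_error_le_pow (Mᵀ * C) e (ℓ := ((1 + ε) ^ 2)⁻¹) (L := (1 + ε) ^ 2) (by positivity)
    ((inv_le_one_of_one_le₀ hle1).trans hle1)
    (fun v => by
      rw [← norm2_sq, ← norm2_sq, inv_mul_le_iff₀ (by positivity), ← mul_pow]
      exact pow_le_pow_left₀ (norm2_nonneg _) (hb v).2 2)
    (fun v => by
      rw [← norm2_sq, ← norm2_sq, ← mul_pow]
      have := (hb v).1
      rw [inv_mul_le_iff₀ h1] at this
      exact pow_le_pow_left₀ (norm2_nonneg _) this 2)
    y _ hw (by rw [← hy]; abel) s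
  rw [h]
  refine key.trans ?_
  rw [dotProduct_self_eq_proj_add B S e, ← hy]
  -- From ε < 1/2, (1+ε)⁻⁴ ≥ (2/3)⁴ = 16/81, and (65/81)⁴ < 1/2.
  have hrate : (1 - ((1 + ε) ^ 2)⁻¹ / (1 + ε) ^ 2) ^ s ≤ 1 / 2 := by
    have hq : (16 : ℝ) / 81 ≤ ((1 + ε) ^ 2)⁻¹ / (1 + ε) ^ 2 := by
      rw [← one_div, div_div, ← pow_add]
      calc (16 : ℝ) / 81 = 1 / (3 / 2) ^ 4 := by norm_num
        _ ≤ _ := by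
          apply one_div_le_one_div_of_le (by positivity)
          exact pow_le_pow_left₀ h1.le (by linarith) 4
    have hq1 : ((1 + ε) ^ 2)⁻¹ / (1 + ε) ^ 2 ≤ 1 := by
      rw [div_le_one (by positivity)]
      exact (inv_le_one_of_one_le₀ hle1).trans hle1
    calc _ ≤ (65 / 81 : ℝ) ^ s := pow_le_pow_left₀ (by linarith) (by linarith) s
      _ ≤ (65 / 81 : ℝ) ^ 4 := pow_le_pow_of_le_one (by norm_num) (by norm_num) hs
      _ ≤ 1 / 2 := by norm_num
  have := mul_le_mul_of_nonneg_right hrate (dotProduct_self_nonneg_real (proj B S *ᵥ e))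
  linarith

end OuterStep

/-! ### The Hadamard transform -/

theorem hadamardMatrix_mul_self (p : ℕ) :
    hadamardMatrix p * hadamardMatrix p = ((2 : ℝ) ^ p) • 1 := by
  induction p with
  | zero => simp [hadamardMatrix]
  | succ p ih =>
    have h : 2 ^ (p + 1) = 2 ^ p + 2 ^ p := by rw [pow_succ, mul_two]
    let e : Fin (2 ^ (p + 1)) ≃ Fin (2 ^ p) ⊕ Fin (2 ^ p) := (finCongr h).trans finSumFinEquiv.symm
    have he : hadamardMatrix (p + 1) = (fromBlocks (hadamardMatrix p) (hadamardMatrix p)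
      (hadamardMatrix p) (-hadamardMatrix p)).submatrix e e := rfl
    rw [he, submatrix_mul_equiv, fromBlocks_multiply]
    simp only [Matrix.mul_neg, Matrix.neg_mul, neg_neg, add_neg_cancel, ih, ← two_smul ℝ, smul_smul,
      ← pow_succ']
    have hb : (fromBlocks ((2 : ℝ) ^ (p + 1) • 1) 0 0 ((2 : ℝ) ^ (p + 1) • 1) :
        Matrix (Fin (2 ^ p) ⊕ Fin (2 ^ p)) (Fin (2 ^ p) ⊕ Fin (2 ^ p)) ℝ) =
        (2 : ℝ) ^ (p + 1) • 1 := by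
      rw [← fromBlocks_one, fromBlocks_smul, smul_zero]
    rw [hb, submatrix_smul, Pi.smul_apply, Pi.smul_apply, submatrix_one_equiv]

/-- H² = 2^p I and the signs are nonzero, so Q is injective and QA has the nullspace of A. -/
theorem rht_mulVec_eq_zero {p : ℕ} {d : Fin (2 ^ p) → ℝ} (hd : ∀ i, d i = 1 ∨ d i = -1)
    {v : Fin (2 ^ p) → ℝ} (h : rht p d *ᵥ v = 0) : v = 0 := by
  have hs : (Real.sqrt ((2 : ℝ) ^ p))⁻¹ ≠ 0 := by positivity
  rw [rht, smul_mulVec, smul_eq_zero_iff_right hs, ← mulVec_mulVec] at h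
  have h2 := congrArg (hadamardMatrix p *ᵥ ·) h
  simp only [mulVec_zero] at h2
  rw [mulVec_mulVec, hadamardMatrix_mul_self, smul_mulVec, one_mulVec, smul_eq_zero_iff_right (by positivity)] at h2
  funext i
  have h3 := congrFun h2 i
  rw [mulVec_diagonal] at h3
  rcases hd i with h4 | h4 <;> simpa [h4] using h3

/-! ### The expected projection -/

section ExpectedProj

variable {m n : ℕ} (τ : ℕ) (B : Matrix (Fin m) (Fin n) ℝ)

theorem dotProduct_expectedProj (e : Fin n → ℝ) :
    e ⬝ᵥ (expectedProj τ B *ᵥ e) = ∑ i : Fin τ → Fin m, ((m : ℝ) ^ τ)⁻¹ *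
      ((proj B (sampleSet i) *ᵥ e) ⬝ᵥ (proj B (sampleSet i) *ᵥ e)) := by
  rw [expectedProj, smul_mulVec, dotProduct_smul, sum_mulVec, dotProduct_sum, smul_eq_mul,
    Finset.mul_sum]
  simp only [dotProduct_proj]

theorem expectedProj_isHermitian : (expectedProj τ B).IsHermitian := by
  rw [Matrix.IsHermitian, conjTranspose_eq_transpose_of_trivial, expectedProj, transpose_smul,
    transpose_sum]
  simp only [proj_transpose]

theorem dotProduct_expectedProj_nonneg (e : Fin n → ℝ) : 0 ≤ e ⬝ᵥ (expectedProj τ B *ᵥ e) := by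
  rw [dotProduct_expectedProj]
  exact Finset.sum_nonneg fun i _ => mul_nonneg (by positivity) (dotProduct_self_nonneg_real _)

theorem dotProduct_expectedProj_le (e : Fin n → ℝ) : e ⬝ᵥ (expectedProj τ B *ᵥ e) ≤ e ⬝ᵥ e := by
  rw [dotProduct_expectedProj]
  calc _ ≤ ∑ i : Fin τ → Fin m, ((m : ℝ) ^ τ)⁻¹ * (e ⬝ᵥ e) := by
        gcongr with i
        rw [dotProduct_self_eq_proj_add B (sampleSet i) e]
        linarith [dotProduct_self_nonneg_real (e - proj B (sampleSet i) *ᵥ e)]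
    _ = (((m : ℝ) ^ τ)⁻¹ * (m : ℝ) ^ τ) * (e ⬝ᵥ e) := by
        simp [mul_assoc, mul_left_comm]
    _ ≤ 1 * (e ⬝ᵥ e) := by
        gcongr
        · exact dotProduct_self_nonneg_real _
        · exact inv_mul_le_one
    _ = _ := one_mul _

variable {τ B} in
theorem mulVec_eq_zero_of_expectedProj (hm : 0 < m) (hτ : 0 < τ) {e : Fin n → ℝ}
    (h : expectedProj τ B *ᵥ e = 0) : B *ᵥ e = 0 := by
  have h1 : e ⬝ᵥ (expectedProj τ B *ᵥ e) = 0 := by rw [h, dotProduct_zero]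
  rw [dotProduct_expectedProj, Finset.sum_eq_zero_iff_of_nonneg
    fun i _ => mul_nonneg (by positivity) (dotProduct_self_nonneg_real _)] at h1
  funext j
  -- Every draw has positive weight, in particular the constant draw j, …, j; as τ > 0, its sample
  -- contains row j.
  have h2 := h1 (fun _ => j) (Finset.mem_univ _)
  have hm' : ((m : ℝ) ^ τ)⁻¹ ≠ 0 := by positivity
  rw [mul_eq_zero_iff_left hm', dotProduct_self_eq_zero] at h2
  have h3 := congrArg (fun M => M *ᵥ e) (mul_proj B (sampleSet (fun _ : Fin τ => j)))
  simp only [← mulVec_mulVec, h2, mulVec_zero] at h3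
  have h4 := congrFun h3 ⟨j, Finset.mem_image.2 ⟨⟨0, hτ⟩, Finset.mem_univ _, rfl⟩⟩
  have h5 : ∀ (S : Finset (Fin m)) (w : Fin m → ℝ) (k : S), (rowSelect S *ᵥ w) k = w k :=
    fun S w k => by simp [rowSelect, mulVec, dotProduct, Matrix.one_apply]
  rw [h5] at h4
  exact h4.symm

end ExpectedProj

/-! ### The smallest positive eigenvalue as a lower bound -/

section Spectral

variable {n : ℕ} {E : Matrix (Fin n) (Fin n) ℝ}

theorem bddBelow_posEigenvalues :
    BddBelow {μ : ℝ | 0 < μ ∧ Module.End.HasEigenvalue (Matrix.toLin' E) μ} :=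
  ⟨0, fun _ h => h.1.le⟩

theorem lambdaMinPos_nonneg : 0 ≤ lambdaMinPos E :=
  Real.sInf_nonneg fun _ h => h.1.le

theorem lambdaMinPos_le_one (hle : ∀ e, e ⬝ᵥ (E *ᵥ e) ≤ e ⬝ᵥ e) : lambdaMinPos E ≤ 1 := by
  -- Without positive eigenvalues the infimum is 0 by convention.
  rcases Set.eq_empty_or_nonempty
    {μ : ℝ | 0 < μ ∧ Module.End.HasEigenvalue (Matrix.toLin' E) μ} with h | ⟨μ, hμ⟩
  · rw [lambdaMinPos, h, Real.sInf_empty]; exact zero_le_one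
  · refine (csInf_le bddBelow_posEigenvalues hμ).trans ?_
    obtain ⟨v, hv⟩ := hμ.2.exists_hasEigenvector
    have h1 := hv.apply_eq_smul
    rw [toLin'_apply] at h1
    have h2 := hle v
    rw [h1, dotProduct_smul, smul_eq_mul] at h2
    have h3 : 0 < v ⬝ᵥ v := lt_of_le_of_ne (dotProduct_self_nonneg_real v)
      fun h => hv.2 (dotProduct_self_eq_zero.1 h.symm)
    exact le_of_mul_le_mul_right (by linarith) h3

/-- In an orthonormal eigenbasis, e has no component along eigenvectors of eigenvalue 0, and all
other eigenvalues are at least the smallest positive one. -/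
theorem lambdaMinPos_mul_le (hE : E.IsHermitian) (hnn : ∀ e, 0 ≤ e ⬝ᵥ (E *ᵥ e)) {e : Fin n → ℝ}
    (he : ∀ z, E *ᵥ z = 0 → e ⬝ᵥ z = 0) : lambdaMinPos E * (e ⬝ᵥ e) ≤ e ⬝ᵥ (E *ᵥ e) := by
  set v : Fin n → Fin n → ℝ := fun i => (hE.eigenvectorBasis i).ofLp
  have hv : ∀ i, E *ᵥ v i = hE.eigenvalues i • v i := fun i => hE.mulVec_eigenvectorBasis i
  have hvv : ∀ i, v i ⬝ᵥ v i = 1 := fun i => by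
    rw [← norm2_sq]
    simp [norm2, v]
  have hparseval : ∀ f g : Fin n → ℝ, f ⬝ᵥ g = ∑ i, (f ⬝ᵥ v i) * (g ⬝ᵥ v i) := fun f g => by
    have := hE.eigenvectorBasis.sum_inner_mul_inner (WithLp.toLp 2 f) (WithLp.toLp 2 g)
    simp only [EuclideanSpace.inner_eq_star_dotProduct, star_trivial] at this
    rw [dotProduct_comm, ← this]
    exact Finset.sum_congr rfl fun i _ => by rw [dotProduct_comm f]
  have hEe : ∀ i, (E *ᵥ e) ⬝ᵥ v i = hE.eigenvalues i * (e ⬝ᵥ v i) := fun i => by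
    rw [mulVec_dotProduct, ← conjTranspose_eq_transpose_of_trivial, hE.eq, hv, dotProduct_smul,
      smul_eq_mul]
  rw [hparseval e (E *ᵥ e), hparseval e e, Finset.mul_sum]
  refine Finset.sum_le_sum fun i _ => ?_
  rw [hEe]
  have hi : 0 ≤ hE.eigenvalues i := by
    have := hnn (v i)
    rwa [hv, dotProduct_smul, hvv, smul_eq_mul, mul_one] at this
  rcases hi.eq_or_lt with h0 | h0
  · rw [he (v i) (by rw [hv, ← h0, zero_smul])]
    simp
  · have h1 : lambdaMinPos E ≤ hE.eigenvalues i := by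
      refine csInf_le bddBelow_posEigenvalues ⟨h0, ?_⟩
      refine Module.End.hasEigenvalue_of_hasEigenvector (x := v i) ⟨?_, fun h => ?_⟩
      · rw [Module.End.mem_eigenspace_iff, toLin'_apply, hv]
      · have := hvv i
        rw [h, zero_dotProduct] at this
        exact zero_ne_one this
    nlinarith [mul_le_mul_of_nonneg_right h1 (mul_self_nonneg (e ⬝ᵥ v i))]

end Spectral

end SketchProject

namespace SketchProject

/-! ### Measurability -/

theorem continuous_norm2 {ι : Type*} [Fintype ι] : Continuous (norm2 : (ι → ℝ) → ℝ) :=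
  continuous_norm.comp (PiLp.continuous_toLp 2 _)

theorem isClosed_embeds {φ n : ℕ} {κ : Type*} [Fintype κ] (ε : ℝ) (K : Matrix (Fin n) κ ℝ) :
    IsClosed {Φ : Fin φ → Fin n → ℝ | Embeds ε (Matrix.of Φ) K} := by
  simp only [Embeds, Set.ofPred_forall, Set.ofPred_and]
  have h : ∀ y, Continuous fun Φ : Fin φ → Fin n → ℝ => norm2 (Matrix.of Φ *ᵥ (K *ᵥ y)) :=
    fun y => continuous_norm2.comp (continuous_id.matrix_mulVec continuous_const)
  exact isClosed_iInter fun y => (isClosed_le continuous_const (h y)).inter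
    (isClosed_le (h y) continuous_const)

/-- The draw takes finitely many values, and for each of them embedding is a closed condition on Φ.
-/
theorem measurableSet_embeds {Ω : Type*} [MeasurableSpace Ω] {m n τ φ : ℕ} (ε : ℝ)
    (B : Matrix (Fin m) (Fin n) ℝ) {D : Ω → Fin τ → Fin m} (hD : Measurable D)
    {Φ : Ω → Matrix (Fin φ) (Fin n) ℝ} (hΦ : ∀ i j, Measurable fun ω => Φ ω i j) :
    MeasurableSet {ω | Embeds ε (Φ ω) (rowSelect (sampleSet (D ω)) * B)ᵀ} := by
  have h : {ω | Embeds ε (Φ ω) (rowSelect (sampleSet (D ω)) * B)ᵀ} =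
      ⋃ i, D ⁻¹' {i} ∩ (fun ω i j => Φ ω i j) ⁻¹'
        {Ψ | Embeds ε (Matrix.of Ψ) (rowSelect (sampleSet i) * B)ᵀ} := by
    ext ω
    simp only [Set.mem_ofPred_eq, Set.mem_iUnion, Set.mem_inter_iff, Set.mem_preimage,
      Set.mem_singleton_iff]
    exact ⟨fun h => ⟨_, rfl, h⟩, fun ⟨_, h1, h2⟩ => h1 ▸ h2⟩
  rw [h]
  refine MeasurableSet.iUnion fun i => (hD (measurableSet_singleton i)).inter ?_
  exact (measurable_pi_lambda _ fun i => measurable_pi_lambda _ fun j => hΦ i j)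
    (isClosed_embeds ε _).measurableSet

theorem measurable_comp_of_countable {Ω ι : Type*} {mΩ : MeasurableSpace Ω} [Countable ι]
    [MeasurableSpace ι] [MeasurableSingletonClass ι] {D : Ω → ι} (hD : Measurable D)
    {h : ι → Ω → ℝ} (hh : ∀ i, Measurable (h i)) : Measurable fun ω => h (D ω) ω :=
  (measurable_from_prod_countable_right (f := fun q : ι × Ω => h q.1 q.2) hh).comp
    (hD.prodMk measurable_id)

/-! ### Conditional expectations -/

section CondExp

variable {Ω : Type*} {G : MeasurableSpace Ω} {mΩ : MeasurableSpace Ω} {μ : Measure Ω}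
  [IsProbabilityMeasure μ]

/-- If `f` is at most `a`, and at most `a - g` on an event of conditional probability at least
`1 - δ`, then its conditional expectation is at most `a - (1 - δ) g`. -/
theorem condExp_le_sub_of_condProb (hG : G ≤ mΩ) {f a g : Ω → ℝ} {E : Set Ω}
    {δ : ℝ} (hE : MeasurableSet E) (hf : Integrable f μ) (ha : StronglyMeasurable[G] a)
    (hai : Integrable a μ) (hg : StronglyMeasurable[G] g) (hgi : Integrable g μ)
    (hg0 : ∀ ω, 0 ≤ g ω) (hfa : ∀ᵐ ω ∂μ, f ω ≤ a ω) (hfE : ∀ᵐ ω ∂μ, ω ∈ E → f ω ≤ a ω - g ω)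
    (hprob : ∀ᵐ ω ∂μ, 1 - δ ≤ (μ⟦E | G⟧) ω) :
    μ[f | G] ≤ᵐ[μ] a - (1 - δ) • g := by
  have h1 : Integrable (E.indicator fun _ => (1 : ℝ)) μ := (integrable_const 1).indicator hE
  have h2 : (g * E.indicator fun _ => (1 : ℝ)) = E.indicator g := by
    funext ω
    by_cases h : ω ∈ E <;> simp [h]
  have h3 : Integrable (g * E.indicator fun _ => (1 : ℝ)) μ := h2 ▸ hgi.indicator hE
  -- Both bounds combine into f ≤ a - g·1_E, where a and g are known given G and only 1_E is
  -- averaged.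
  have h4 : f ≤ᵐ[μ] a - g * E.indicator fun _ => (1 : ℝ) := by
    filter_upwards [hfa, hfE] with ω hω hωE
    by_cases h : ω ∈ E
    · simpa [h] using hωE h
    · simpa [h] using hω
  have h5 := condExp_mono (m := G) hf (hai.sub h3) h4
  have h6 := condExp_sub hai h3 G
  have h7 := condExp_mul_of_stronglyMeasurable_left hg h3 h1
  rw [condExp_of_stronglyMeasurable hG ha hai] at h6
  filter_upwards [h5, h6, h7, hprob] with ω e5 e6 e7 e8
  rw [e6, Pi.sub_apply, e7, Pi.mul_apply] at e5
  have := mul_le_mul_of_nonneg_left e8 (hg0 ω)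
  simp only [Pi.sub_apply, Pi.smul_apply, smul_eq_mul]
  linarith

/-- Freezing lemma for a draw `D` with finitely many values that is independent of `G`. -/
theorem condExp_comp_of_indep {ι : Type*} [Fintype ι] [MeasurableSpace ι]
    [MeasurableSingletonClass ι] (hG : G ≤ mΩ) {D : Ω → ι}
    (hD : Measurable D) (hind : Indep (MeasurableSpace.comap D inferInstance) G μ)
    {h : ι → Ω → ℝ} (hm : ∀ i, StronglyMeasurable[G] (h i)) (hi : ∀ i, Integrable (h i) μ) :
    μ[fun ω => h (D ω) ω | G] =ᵐ[μ] fun ω => ∑ i, μ.real (D ⁻¹' {i}) * h i ω := by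
  classical
  have hms : ∀ i, MeasurableSet (D ⁻¹' {i}) := fun i => hD (measurableSet_singleton i)
  have hprod : ∀ i, ((D ⁻¹' {i}).indicator (fun _ => (1 : ℝ)) * h i) =
      (D ⁻¹' {i}).indicator (h i) := fun i => by
    funext ω
    by_cases hω : ω ∈ D ⁻¹' {i}
    · rw [Pi.mul_apply, Set.indicator_of_mem hω, Set.indicator_of_mem hω, one_mul]
    · rw [Pi.mul_apply, Set.indicator_of_notMem hω, Set.indicator_of_notMem hω, zero_mul]
  have hsum : (fun ω => h (D ω) ω) =
      ∑ i, (D ⁻¹' {i}).indicator (fun _ => (1 : ℝ)) * h i := by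
    funext ω
    rw [Finset.sum_apply, Finset.sum_eq_single (D ω)]
    · simp
    · intro i _ hne
      simp [Set.indicator, Ne.symm hne]
    · simp
  have hint : ∀ i, Integrable ((D ⁻¹' {i}).indicator (fun _ => (1 : ℝ)) * h i) μ := fun i => by
    rw [hprod]
    exact (hi i).indicator (hms i)
  rw [hsum]
  have h1 := condExp_finsetSum (s := Finset.univ) (fun i _ => hint i) G
  have h2 : ∀ i, μ[(D ⁻¹' {i}).indicator (fun _ => (1 : ℝ)) * h i | G] =ᵐ[μ]
      fun ω => μ.real (D ⁻¹' {i}) * h i ω := fun i => by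
    have h3 := condExp_mul_of_stronglyMeasurable_right (hm i) (hint i)
      ((integrable_const 1).indicator (hms i))
    have h4 := condExp_indep_eq (μ := μ) hD.comap_le hG
      (f := (D ⁻¹' {i}).indicator (fun _ => (1 : ℝ)))
      (stronglyMeasurable_const.indicator ⟨{i}, measurableSet_singleton i, rfl⟩) hind
    filter_upwards [h3, h4] with ω e3 e4
    rw [e3, Pi.mul_apply, e4, integral_indicator_const _ (hms i), smul_eq_mul, mul_one]
  filter_upwards [h1, ae_all_iff.2 h2] with ω e1 e2
  rw [e1, Finset.sum_apply]
  exact Finset.sum_congr rfl fun i _ => e2 i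

end CondExp

/-! ### The run -/

theorem mulVec_pinv_mulVec {ι κ : Type*} [Fintype ι] [Fintype κ] {A : Matrix ι κ ℝ} {b : ι → ℝ}
    (hb : ∃ z, A *ᵥ z = b) : A *ᵥ (pinv A *ᵥ b) = b := by
  obtain ⟨z, rfl⟩ := hb
  rw [mulVec_mulVec, mulVec_mulVec, (pinv_spec A).mul_mul_left]

section Run

variable {p n τ φ : ℕ} {Ω : Type*} [mΩ : MeasurableSpace Ω] {μ : Measure Ω}
  {A : Matrix (Fin (2 ^ p)) (Fin n) ℝ} {b : Fin (2 ^ p) → ℝ} {d : Fin (2 ^ p) → ℝ}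
  {ε δ : ℝ} {smax tmax : ℕ} {x₀ : Fin n → ℝ} {F : Filtration ℕ mΩ}
  {draw : ℕ → Ω → Fin τ → Fin (2 ^ p)} {Φ : ℕ → Ω → Matrix (Fin φ) (Fin n) ℝ}
  {x : ℕ → Ω → Fin n → ℝ}

namespace IsRun

theorem step_mulVec (h : IsRun μ A b d ε δ smax tmax x₀ F draw Φ x) (hb : ∃ z, A *ᵥ z = b)
    {t : ℕ} (ht : t < tmax) :
    ∀ᵐ ω ∂μ, IsOuterStep (rht p d * A) ((rht p d * A) *ᵥ (pinv A *ᵥ b)) smax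
      (sampleSet (draw t ω)) (Φ t ω) (x t ω) (x (t + 1) ω) := by
  rw [← mulVec_mulVec, mulVec_pinv_mulVec hb]
  exact h.step t ht

/-- Monotonicity of CG gives a deterministic bound, hence integrability. -/
theorem error_bound (h : IsRun μ A b d ε δ smax tmax x₀ F draw Φ x) (hb : ∃ z, A *ᵥ z = b)
    {t : ℕ} (ht : t ≤ tmax) :
    ∀ᵐ ω ∂μ, norm2 (x t ω - pinv A *ᵥ b) ^ 2 ≤ norm2 (x₀ - pinv A *ᵥ b) ^ 2 := by
  induction t with
  | zero =>
    filter_upwards [h.init] with ω hω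
    rw [hω]
  | succ t ih =>
    filter_upwards [ih (by lia), h.step_mulVec hb (t := t) (by lia)] with ω h1 h2
    refine le_trans ?_ h1
    rw [norm2_sq, norm2_sq]
    exact h2.error_le

theorem error_orthogonal (h : IsRun μ A b d ε δ smax tmax x₀ F draw Φ x) (hb : ∃ z, A *ᵥ z = b)
    (hd : ∀ i, d i = 1 ∨ d i = -1)
    (hx₀ : ∀ z : Fin n → ℝ, A *ᵥ z = 0 → (x₀ - pinv A *ᵥ b) ⬝ᵥ z = 0) {t : ℕ} (ht : t ≤ tmax) :
    ∀ᵐ ω ∂μ, ∀ z, (rht p d * A) *ᵥ z = 0 → (x t ω - pinv A *ᵥ b) ⬝ᵥ z = 0 := by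
  induction t with
  | zero =>
    filter_upwards [h.init] with ω hω z hz
    rw [hω]
    rw [← mulVec_mulVec] at hz
    exact hx₀ z (rht_mulVec_eq_zero hd hz)
  | succ t ih =>
    filter_upwards [ih (by lia), h.step_mulVec hb (t := t) (by lia)] with ω h1 h2 z hz
    exact h2.dotProduct_eq_zero hz (h1 z hz)

theorem stronglyMeasurable_comp_error (h : IsRun μ A b d ε δ smax tmax x₀ F draw Φ x) {t : ℕ}
    (ht : t ≤ tmax) {f : (Fin n → ℝ) → ℝ} (hf : Continuous f) :
    StronglyMeasurable[F t] fun ω => f (x t ω - pinv A *ᵥ b) :=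
  ((hf.comp (continuous_id.sub continuous_const)).measurable.comp
    (h.adapted t ht)).stronglyMeasurable

variable [IsProbabilityMeasure μ]

theorem integrable_error (h : IsRun μ A b d ε δ smax tmax x₀ F draw Φ x)
    (hb : ∃ z, A *ᵥ z = b) {t : ℕ} (ht : t ≤ tmax) :
    Integrable (fun ω => norm2 (x t ω - pinv A *ᵥ b) ^ 2) μ := by
  refine Integrable.of_bound ((h.stronglyMeasurable_comp_error ht (continuous_norm2.pow 2)).mono
    (F.le t)).aestronglyMeasurable (norm2 (x₀ - pinv A *ᵥ b) ^ 2) ?_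
  filter_upwards [h.error_bound hb ht] with ω hω
  rwa [Real.norm_of_nonneg (sq_nonneg _)]

/-- One outer iteration decreases the conditional expectation of the squared error by a quarter
of the expected squared norm of the projected error. -/
theorem condExp_error_le (h : IsRun μ A b d ε δ smax tmax x₀ F draw Φ x)
    (hb : ∃ z, A *ᵥ z = b) (hε : 0 < ε) (hε' : ε < 1 / 2) (hδ : δ < 1 / 2) (hs : 4 ≤ smax)
    {t : ℕ} (ht : t < tmax) :
    μ[fun ω => norm2 (x (t + 1) ω - pinv A *ᵥ b) ^ 2 | F t] ≤ᵐ[μ] fun ω =>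
      norm2 (x t ω - pinv A *ᵥ b) ^ 2 - 1 / 4 * ((x t ω - pinv A *ᵥ b) ⬝ᵥ
        (expectedProj τ (rht p d * A) *ᵥ (x t ω - pinv A *ᵥ b))) := by
  set B := rht p d * A with hB
  set xs := pinv A *ᵥ b with hxs
  have hD := h.measurable_draw t ht
  have hG : F t ⊔ MeasurableSpace.comap (draw t) inferInstance ≤ mΩ := sup_le (F.le t) hD.comap_le
  have hFG : F t ≤ F t ⊔ MeasurableSpace.comap (draw t) inferInstance := le_sup_left
  set f : Ω → ℝ := fun ω => norm2 (x (t + 1) ω - xs) ^ 2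
  set a : Ω → ℝ := fun ω => norm2 (x t ω - xs) ^ 2
  set r : (Fin τ → Fin (2 ^ p)) → Ω → ℝ := fun i ω =>
    (1 / 2) * norm2 (proj B (sampleSet i) *ᵥ (x t ω - xs)) ^ 2 with hr
  set g : Ω → ℝ := fun ω => r (draw t ω) ω
  have ha : StronglyMeasurable[F t] a :=
    h.stronglyMeasurable_comp_error ht.le (continuous_norm2.pow 2)
  have hai : Integrable a μ := h.integrable_error hb ht.le
  have hfi : Integrable f μ := h.integrable_error hb ht
  have hrm : ∀ i, StronglyMeasurable[F t] (r i) := fun i =>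
    h.stronglyMeasurable_comp_error ht.le (f := fun v => (1 / 2) *
      norm2 (proj B (sampleSet i) *ᵥ v) ^ 2) (continuous_const.mul
        ((continuous_norm2.comp (continuous_const.matrix_mulVec continuous_id)).pow 2))
  have hr0 : ∀ i ω, 0 ≤ r i ω := fun i ω => by positivity
  have hra : ∀ i ω, r i ω ≤ a ω := fun i ω => by
    simp only [hr, a, norm2_sq, dotProduct_self_eq_proj_add B (sampleSet i) (x t ω - xs)]
    linarith [dotProduct_self_nonneg_real (proj B (sampleSet i) *ᵥ (x t ω - xs)),
      dotProduct_self_nonneg_real (x t ω - xs - proj B (sampleSet i) *ᵥ (x t ω - xs))]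
  have hri : ∀ i, Integrable (r i) μ := fun i =>
    hai.mono' ((hrm i).mono (F.le t)).aestronglyMeasurable
      (ae_of_all _ fun ω => by rw [Real.norm_of_nonneg (hr0 i ω)]; exact hra i ω)
  have hgm : StronglyMeasurable[F t ⊔ MeasurableSpace.comap (draw t) inferInstance] g := by
    have hDG : Measurable[F t ⊔ MeasurableSpace.comap (draw t) inferInstance] (draw t) :=
      Measurable.mono (comap_measurable _) le_sup_right le_rfl
    exact (measurable_comp_of_countable hDG fun i =>
      ((hrm i).mono hFG).measurable).stronglyMeasurable
  have hgi : Integrable g μ :=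
    hai.mono' (hgm.mono hG).aestronglyMeasurable
      (ae_of_all _ fun ω => by rw [Real.norm_of_nonneg (hr0 _ ω)]; exact hra _ ω)
  have hstep := h.step_mulVec hb ht
  -- Condition first on the past and the draws, where P_S e is known and the sketch guarantee
  -- applies; the tower property then returns to F t.
  have h1 : μ[f | F t ⊔ MeasurableSpace.comap (draw t) inferInstance] ≤ᵐ[μ] a - (1 - δ) • g := by
    have hE := measurableSet_embeds ε B hD (h.measurable_sketch t ht)
    have hp := h.embeds t ht
    rw [← hB] at hp
    refine condExp_le_sub_of_condProb (f := f) (a := a) (g := g) (δ := δ) hG hE hfi (ha.mono hFG)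
      hai hgm hgi (fun ω => hr0 _ ω) ?_ ?_ hp
    · filter_upwards [hstep] with ω hω
      simp only [f, a, norm2_sq]
      exact hω.error_le
    · filter_upwards [hstep] with ω hω hE
      simp only [f, a, g, hr, norm2_sq]
      exact hω.error_le_of_embeds hε hε' hs hE
  have h2 := condExp_mono (m := F t) integrable_condExp (hai.sub (hgi.smul (1 - δ))) h1
  have h3 := condExp_condExp_of_le (μ := μ) (f := f) hFG hG
  have h4 := condExp_sub hai (hgi.smul (1 - δ)) (F t)
  have h5 := condExp_smul (μ := μ) (1 - δ) g (F t)
  have h6 := condExp_comp_of_indep (F.le t) hD (h.indep_draw t ht) hrm hri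
  rw [condExp_of_stronglyMeasurable (F.le t) ha hai] at h4
  filter_upwards [h2, h3, h4, h5, h6] with ω e2 e3 e4 e5 e6
  rw [e3, e4, Pi.sub_apply, e5, Pi.smul_apply, e6, smul_eq_mul] at e2
  refine e2.trans ?_
  have hexp : ∑ i, μ.real (draw t ⁻¹' {i}) * r i ω =
      1 / 2 * ((x t ω - xs) ⬝ᵥ (expectedProj τ B *ᵥ (x t ω - xs))) := by
    rw [dotProduct_expectedProj, Finset.mul_sum]
    refine Finset.sum_congr rfl fun i _ => ?_
    rw [h.uniform_draw t ht, hr, ← norm2_sq]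
    push_cast
    ring
  rw [hexp]
  -- Nonnegativity allows (1-δ)/2 to be lowered to 1/4.
  have := dotProduct_expectedProj_nonneg τ B (x t ω - xs)
  nlinarith

end IsRun

end Run

end SketchProject

theorem lemma4p3 :
    ∃ C : ℝ, 0 < C ∧
      ∀ (p n τ φ : ℕ) (A : Matrix (Fin (2 ^ p)) (Fin n) ℝ) (b : Fin (2 ^ p) → ℝ)
        (d : Fin (2 ^ p) → ℝ) (ε δ : ℝ) (smax tmax : ℕ) (x₀ : Fin n → ℝ)
        (Ω : Type*) [mΩ : MeasurableSpace Ω] (μ : Measure Ω) [IsProbabilityMeasure μ]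
        (F : Filtration ℕ mΩ) (draw : ℕ → Ω → Fin τ → Fin (2 ^ p))
        (Φ : ℕ → Ω → Matrix (Fin φ) (Fin n) ℝ) (x : ℕ → Ω → Fin n → ℝ),
        A ≠ 0 → 0 < τ →
        (∃ z : Fin n → ℝ, A *ᵥ z = b) →
        (∀ i, d i = 1 ∨ d i = -1) →
        0 < ε → ε < 1 / 2 → 0 ≤ δ → δ < 1 / 2 →
        (∀ z : Fin n → ℝ, A *ᵥ z = 0 → (x₀ - pinv A *ᵥ b) ⬝ᵥ z = 0) →
        C * (1 + Real.log (1 / lambdaMinPos (expectedProj τ (rht p d * A)))) ≤ smax →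
        IsRun μ A b d ε δ smax tmax x₀ F draw Φ x →
        ∀ t < tmax,
          Integrable (fun ω => norm2 (x (t + 1) ω - pinv A *ᵥ b) ^ 2) μ ∧
          μ[fun ω => norm2 (x (t + 1) ω - pinv A *ᵥ b) ^ 2 | F t] ≤ᵐ[μ]
            fun ω => (1 - lambdaMinPos (expectedProj τ (rht p d * A)) / 4) *
              norm2 (x t ω - pinv A *ᵥ b) ^ 2 := by
  -- Four inner steps suffice for the halving; since ρ ≤ 1 the logarithm is nonnegative, so C = 4
  -- forces `4 ≤ smax`.
  refine ⟨4, by norm_num, ?_⟩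
  intro p n τ φ A b d ε δ smax tmax x₀ Ω mΩ μ _ F draw Φ x _ hτ hb hd hε hε' _ hδ hx₀ hC hrun t ht
  have hρ1 : lambdaMinPos (expectedProj τ (rht p d * A)) ≤ 1 :=
    lambdaMinPos_le_one (dotProduct_expectedProj_le τ _)
  have hlog : 0 ≤ Real.log (1 / lambdaMinPos (expectedProj τ (rht p d * A))) := by
    rw [one_div, Real.log_inv, neg_nonneg]
    exact Real.log_nonpos lambdaMinPos_nonneg hρ1
  have hs : 4 ≤ smax := by
    have : (4 : ℝ) ≤ smax := by linarith
    exact_mod_cast this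
  refine ⟨hrun.integrable_error hb ht, ?_⟩
  filter_upwards [hrun.condExp_error_le hb hε hε' hδ hs ht,
    hrun.error_orthogonal hb hd hx₀ ht.le] with ω h1 h2
  refine h1.trans ?_
  have h3 := lambdaMinPos_mul_le (expectedProj_isHermitian τ (rht p d * A))
    (dotProduct_expectedProj_nonneg τ _) fun z hz =>
      h2 z (mulVec_eq_zero_of_expectedProj (by positivity) hτ hz)
  rw [norm2_sq]
  linarith
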